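/- **Setting.** Let $A=(a_{ij})_{i,j\in I}$, $I=\{1,\dots,n\}$, be a symmetrizable generalized Cartan matrix with symmetrizer $D=\mathrm{diag}(r_1,\dots,r_n)$, $r_i\in\mathbb Z_{>0}$, put $b_{ij}=r_ia_{ij}$, and let $(\mathfrak h,\{\alpha_i\},\{\alpha_i^\vee\})$ be a realization of $A$ with $\dim\mathfrak h=2n-\mathrm{rank}\,A$. Over $\mathbb C(v)$ put $v_i=v^{r_i}$ and $[l]_v=\frac{v^{-l}-v^l}{v^{-1}-v}$ ($l\in\mathbb Z$). The quantum loop algebra $U_v(\mathcal L\mathfrak g)$ is the $\mathbb C(v)$-algebra generated by $E_{i,l},F_{i,l}$ ($i\in I$, $l\in\mathbb Z$), $H_{i,s}$ ($i\in I$, $s\in\mathbb Z\setminus\{0\}$) and $K_h$ ($h\in\mathfrak h$ with $\alpha_j(h)\in\mathbb Z$ for all $j$) with the relations $$K_hK_{h'}=K_{h+h'},\quad K_0=1,\quad [K_h,H_{j,s}]=[H_{i,s},H_{j,t}]=0,$$ $$K_hE_{j,l}K_{-h}=v^{-\alpha_j(h)}E_{j,l},\quad K_hF_{j,l}K_{-h}=v^{\alpha_j(h)}F_{j,l},$$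 $$[H_{i,s},E_{j,l}]=\tfrac{[sb_{ij}]_v}{s}E_{j,s+l},\quad [H_{i,s},F_{j,l}]=-\tfrac{[sb_{ij}]_v}{s}F_{j,s+l},\quad [E_{i,l},F_{j,m}]=\delta_{ij}\frac{\phi^+_{i,l+m}-\phi^-_{i,l+m}}{v_i^{-1}-v_i},$$ $$v^{b_{ij}}E_{i,l+1}E_{j,m}-E_{j,m}E_{i,l+1}=E_{i,l}E_{j,m+1}-v^{b_{ij}}E_{j,m+1}E_{i,l},$$ $$v^{-b_{ij}}F_{i,l+1}F_{j,m}-F_{j,m}F_{i,l+1}=F_{i,l}F_{j,m+1}-v^{-b_{ij}}F_{j,m+1}F_{i,l},$$ and, for $i\ne j$, $r=1-a_{ij}$ and all $l_1,\dots,l_r,l'\in\mathbb Z$, $$\sum_{\sigma\in\mathfrak S_r}\sum_{k=0}^r(-1)^k\begin{bmatrix}r\\k\end{bmatrix}_{v_i}E_{i,l_{\sigma(1)}}\cdots E_{i,l_{\sigma(k)}}E_{j,l'}E_{i,l_{\sigma(k+1)}}\cdots E_{i,l_{\sigma(r)}}=0,$$ together with the same relation for the $F$'s. Here $\sum_{s\ge0}\phi^\pm_{i,\pm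 s}z^{\pm s}=K_{\pm r_i\alpha_i^\vee}\exp\big(\pm(v^{-1}-v)\sum_{s\ge1}H_{i,\pm s}z^{\pm s}\big)$ and $\phi^{\pm}_{i,\pm s}=0$ for $s<0$. Put $\sum_{s\ge0}\theta^+_{i,s}z^s=\exp\big((v^{-1}-v)\sum_{s\ge1}H_{i,s}z^s\big)$. Let $U_v^+(\mathcal L\mathfrak g)$ be the subalgebra generated by all $E_{i,l}$ and all $H_{i,s}$ with $s\ge1$, and $U_v(\mathcal L\mathfrak n)$ the subalgebra generated by all $E_{i,l}$. Give $E_{i,l}$ the weight $\alpha_i$ and $H_{i,s}$ the weight $0$, and put $(\alpha_i,\alpha_j)=b_{ij}$. On the completed tensor square use the product $(x_1\otimes x_2)(y_1\otimes y_2)=v^{-(\mathrm{wt}\,x_2,\mathrm{wt}\,y_1)}x_1y_1\otimes x_2y_2$. Let $\Delta'$ be the algebra homomorphism with $$\Delta'(E_{i,l})=E_{i,l}\otimes1+\sum_{t\ge0}\theta^+_{i,t}\otimes E_{i,l-t},\qquad \Delta'(\theta^+_{i,m})=\sum_{0\le t\le m}\theta^+_{i,m-t}\otimes\theta^+_{i,t}$$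 (the second condition says that all $H_{i,s}$, $s\ge1$, are primitive), and let $(\ ,\ )$ be the symmetric Hopf pairing, $(x,yz)=(\Delta'(x),y\otimes z)$, with $$(E_{i,k},E_{j,l})=\frac{\delta_{ij}\delta_{kl}}{v^{-2}-1},\qquad (H_{i,s},H_{j,t})=\delta_{st}\frac{[sb_{ij}]_v}{s(v^{-1}-v)},\qquad (E_{i,k},H_{j,s})=0 .$$ For $i\in I$, $m\in\mathbb Z$ put $F'_{i,m}(x)=\sum(v^{-2}-1)(E_{i,m},x_{(1)})\,x_{(2)}$, where $\Delta'(x)=\sum x_{(1)}\otimes x_{(2)}$. No well-definedness modulo the relations is presupposed: $\Delta'$, $(\ ,\ )$ and $F'_{i,m}$ are computed on the free algebra on the generators $E_{i,l}$ ($l\in\mathbb Z$), $H_{i,s}$ ($s\ge1$), and $\pi$ denotes the canonical homomorphism from this free algebra onto $U_v^+(\mathcal L\mathfrak g)$. Let $T_E$ be the free subalgebra on the $E_{i,l}$, so that $\pi(T_E)=U_v(\mathcal L\mathfrak n)$. **Statement.** Let $i\in I$ and $k\in\mathbb Z$. 1. The common kernel $$Z'_{i,k}=\{\pi(x)\;:\;x\in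 T_E,\ \pi(F'_{i,m}(x))=0\text{ for all }m\le k\}$$ is a (unital) subalgebra of $U_v(\mathcal L\mathfrak n)$. 2. If $(F'_{i,m})_{m\in\mathbb Z}$ are linear operators on $U_v(\mathcal L\mathfrak n)$ given by the formula above, that is, $F'_{i,m}(\pi(x))=\pi(F'_{i,m}(x))$ for all $x\in T_E$ and $m\in\mathbb Z$, then $\bigcap_{m\le k}\ker F'_{i,m}$ is a (unital) subalgebra of $U_v(\mathcal L\mathfrak n)$. -/

import Mathlib

noncomputable section

namespace QLoop

open scoped BigOperators

/-! ### The ground field `ℂ(v)` and quantum integers -/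

/-- The field `ℂ(v)`. -/
abbrev Kv : Type := RatFunc ℂ

/-- The indeterminate `v`. -/
def v : Kv := RatFunc.X

/-- The quantum integer `[l]_x = (x^{-l} - x^l) / (x^{-1} - x)`, for any integer `l`. -/
def qInt (x : Kv) (l : ℤ) : Kv := (x ^ (-l) - x ^ l) / (x⁻¹ - x)

/-- `[l]_x! = [l]_x [l-1]_x ⋯ [1]_x`. -/
def qFact (x : Kv) (l : ℕ) : Kv := ∏ s ∈ Finset.range l, qInt x (s + 1)

/-- The Gaussian binomial coefficient. -/
def qBinom (x : Kv) (r k : ℕ) : Kv := qFact x r / (qFact x k * qFact x (r - k))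

/-- The coefficient of `z^m` in `exp (c ∑_{s ≥ 1} a_s z^s)`, for elements `a_s` of an algebra.
Since the exponent has no constant term, only the powers up to `m` contribute. -/
def expCoeff {A : Type*} [Ring A] [Algebra Kv A] (c : Kv) (a : ℕ+ → A) (m : ℕ) : A :=
  ∑ k ∈ Finset.range (m + 1), ((k.factorial : Kv)⁻¹) •
    PowerSeries.coeff m
      ((PowerSeries.mk fun s : ℕ => if h : 0 < s then c • a ⟨s, h⟩ else 0) ^ k)

/-! ### Symmetrizable generalized Cartan matrices and their realizations -/

/-- A symmetrizable generalized Cartan matrix `A = (a i j)` with a symmetrizer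
`D = diag (r_1, …, r_n)`. -/
structure CartanDatum (n : ℕ) where
  a : Matrix (Fin n) (Fin n) ℤ
  r : Fin n → ℕ
  diag : ∀ i, a i i = 2
  off_diag : ∀ i j, i ≠ j → a i j ≤ 0
  zero_iff : ∀ i j, a i j = 0 ↔ a j i = 0
  r_pos : ∀ i, 0 < r i
  symm : ∀ i j, (r i : ℤ) * a i j = r j * a j i

/-- The symmetrized matrix `B = D A`; also `b i j = (α_i, α_j)`. -/
def CartanDatum.b {n : ℕ} (C : CartanDatum n) (i j : Fin n) : ℤ := C.r i * C.a i j

/-- A realization `(𝔥, 𝔥^*, Π, Π^∨)` of the Cartan matrix. -/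
structure Realization {n : ℕ} (C : CartanDatum n) (𝔥 : Type*) [AddCommGroup 𝔥] [Module ℂ 𝔥] where
  root : Fin n → Module.Dual ℂ 𝔥
  coroot : Fin n → 𝔥
  finite : FiniteDimensional ℂ 𝔥
  root_indep : LinearIndependent ℂ root
  coroot_indep : LinearIndependent ℂ coroot
  pairing : ∀ i j, root j (coroot i) = (C.a i j : ℂ)
  dim_eq : Module.finrank ℂ 𝔥 + (C.a.map (Int.cast : ℤ → ℂ)).rank = 2 * n

section LoopAlgebra

variable {n : ℕ} {C : CartanDatum n} {𝔥 : Type*} [AddCommGroup 𝔥] [Module ℂ 𝔥]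

/-- The lattice of those `h ∈ 𝔥` on which all simple roots take integral values; these are the
`h` for which `v^{α_j(h)}` makes sense in `ℂ(v)`. -/
def Realization.lattice (ρ : Realization C 𝔥) : AddSubgroup 𝔥 where
  carrier := {h | ∀ j, ∃ m : ℤ, ρ.root j h = m}
  zero_mem' := fun j => ⟨0, by simp⟩
  add_mem' := by
    intro x y hx hy j
    obtain ⟨p, hp⟩ := hx j
    obtain ⟨q, hq⟩ := hy j
    exact ⟨p + q, by simp [hp, hq]⟩
  neg_mem' := by
    intro x hx j
    obtain ⟨p, hp⟩ := hx j
    exact ⟨-p, by simp [hp]⟩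

/-- The element `r_i α_i^∨` of the lattice. -/
def Realization.rcoroot (ρ : Realization C 𝔥) (i : Fin n) : ρ.lattice :=
  ⟨(C.r i : ℂ) • ρ.coroot i, fun j => ⟨C.r i * C.a i j, by simp [ρ.pairing]⟩⟩

/-- The generators `E_{i,l}`, `F_{i,l}`, `K_h`, `H_{i,s}` (`s ≠ 0`) of the quantum loop algebra. -/
inductive Gen (ρ : Realization C 𝔥) : Type _
  | E (i : Fin n) (l : ℤ) : Gen ρ
  | F (i : Fin n) (l : ℤ) : Gen ρ
  | K (h : ρ.lattice) : Gen ρ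
  | H (i : Fin n) (s : {s : ℤ // s ≠ 0}) : Gen ρ

/-- The free `ℂ(v)`-algebra on the generators. -/
abbrev FreeU (ρ : Realization C 𝔥) : Type _ := FreeAlgebra Kv (Gen ρ)

def gE (ρ : Realization C 𝔥) (i : Fin n) (l : ℤ) : FreeU ρ := FreeAlgebra.ι Kv (Gen.E i l)

def gF (ρ : Realization C 𝔥) (i : Fin n) (l : ℤ) : FreeU ρ := FreeAlgebra.ι Kv (Gen.F i l)

def gK (ρ : Realization C 𝔥) (h : ρ.lattice) : FreeU ρ := FreeAlgebra.ι Kv (Gen.K h)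

def gH (ρ : Realization C 𝔥) (i : Fin n) (s : {s : ℤ // s ≠ 0}) : FreeU ρ :=
  FreeAlgebra.ι Kv (Gen.H i s)

/-- The index `s ≥ 1` as a nonzero integer. -/
def posIdx (s : ℕ+) : {s : ℤ // s ≠ 0} := ⟨((s : ℕ) : ℤ), by exact_mod_cast s.ne_zero⟩

/-- The index `-s ≤ -1` as a nonzero integer. -/
def negIdx (s : ℕ+) : {s : ℤ // s ≠ 0} :=
  ⟨-((s : ℕ) : ℤ), neg_ne_zero.mpr (by exact_mod_cast s.ne_zero)⟩

/-- `φ^+_{i,m}`: the coefficient of `z^m` in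
`K_{r_i α_i^∨} exp ((v^{-1} - v) ∑_{s ≥ 1} H_{i,s} z^s)`, and `0` for `m < 0`. -/
def phiPlus (ρ : Realization C 𝔥) (i : Fin n) (m : ℤ) : FreeU ρ :=
  if 0 ≤ m then gK ρ (ρ.rcoroot i) *
    expCoeff (v⁻¹ - v) (fun s => gH ρ i (posIdx s)) m.toNat else 0

/-- `φ^-_{i,m}`: the coefficient of `z^m` in
`K_{-r_i α_i^∨} exp (-(v^{-1} - v) ∑_{s ≥ 1} H_{i,-s} z^{-s})`, and `0` for `m > 0`. -/
def phiMinus (ρ : Realization C 𝔥) (i : Fin n) (m : ℤ) : FreeU ρ :=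
  if m ≤ 0 then gK ρ (-ρ.rcoroot i) *
    expCoeff (-(v⁻¹ - v)) (fun s => gH ρ i (negIdx s)) (-m).toNat else 0

/-- The left-hand side of the loop Serre relation for `x_{i,l_1}, …, x_{i,l_r}` and `y`. -/
def serreSum {A : Type*} [Ring A] [Algebra Kv A] (q : Kv) (r : ℕ) (x : Fin r → A) (y : A) : A :=
  ∑ σ : Equiv.Perm (Fin r), ∑ k ∈ Finset.range (r + 1), ((-1) ^ k * qBinom q r k) •
    (((List.ofFn fun t => x (σ t)).take k).prod * y *
      ((List.ofFn fun t => x (σ t)).drop k).prod)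

/-- The defining relations of the quantum loop algebra. -/
inductive LoopRel (ρ : Realization C 𝔥) : FreeU ρ → FreeU ρ → Prop
  | K_add (h h' : ρ.lattice) : LoopRel ρ (gK ρ h * gK ρ h') (gK ρ (h + h'))
  | K_zero : LoopRel ρ (gK ρ 0) 1
  | K_H (h : ρ.lattice) (j : Fin n) (s : {s : ℤ // s ≠ 0}) :
      LoopRel ρ (gK ρ h * gH ρ j s) (gH ρ j s * gK ρ h)
  | H_H (i j : Fin n) (s t : {s : ℤ // s ≠ 0}) :
      LoopRel ρ (gH ρ i s * gH ρ j t) (gH ρ j t * gH ρ i s)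
  | K_E (h : ρ.lattice) (j : Fin n) (l m : ℤ) (hm : ρ.root j h = m) :
      LoopRel ρ (gK ρ h * gE ρ j l * gK ρ (-h)) (v ^ (-m) • gE ρ j l)
  | K_F (h : ρ.lattice) (j : Fin n) (l m : ℤ) (hm : ρ.root j h = m) :
      LoopRel ρ (gK ρ h * gF ρ j l * gK ρ (-h)) (v ^ m • gF ρ j l)
  | H_E (i j : Fin n) (s : {s : ℤ // s ≠ 0}) (l : ℤ) :
      LoopRel ρ (gH ρ i s * gE ρ j l - gE ρ j l * gH ρ i s)
        ((qInt v (s * C.b i j) / ((s : ℤ) : Kv)) • gE ρ j (s + l))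
  | H_F (i j : Fin n) (s : {s : ℤ // s ≠ 0}) (l : ℤ) :
      LoopRel ρ (gH ρ i s * gF ρ j l - gF ρ j l * gH ρ i s)
        (-(qInt v (s * C.b i j) / ((s : ℤ) : Kv)) • gF ρ j (s + l))
  | E_F (i : Fin n) (l m : ℤ) :
      LoopRel ρ (gE ρ i l * gF ρ i m - gF ρ i m * gE ρ i l)
        (((v ^ C.r i)⁻¹ - v ^ C.r i)⁻¹ • (phiPlus ρ i (l + m) - phiMinus ρ i (l + m)))
  | E_F_ne (i j : Fin n) (hij : i ≠ j) (l m : ℤ) :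
      LoopRel ρ (gE ρ i l * gF ρ j m) (gF ρ j m * gE ρ i l)
  | E_E (i j : Fin n) (l m : ℤ) :
      LoopRel ρ (v ^ C.b i j • (gE ρ i (l + 1) * gE ρ j m) - gE ρ j m * gE ρ i (l + 1))
        (gE ρ i l * gE ρ j (m + 1) - v ^ C.b i j • (gE ρ j (m + 1) * gE ρ i l))
  | F_F (i j : Fin n) (l m : ℤ) :
      LoopRel ρ (v ^ (-C.b i j) • (gF ρ i (l + 1) * gF ρ j m) - gF ρ j m * gF ρ i (l + 1))
        (gF ρ i l * gF ρ j (m + 1) - v ^ (-C.b i j) • (gF ρ j (m + 1) * gF ρ i l))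
  | serre_E (i j : Fin n) (hij : i ≠ j) (l : Fin (1 - C.a i j).toNat → ℤ) (l' : ℤ) :
      LoopRel ρ (serreSum (v ^ C.r i) (1 - C.a i j).toNat (fun t => gE ρ i (l t)) (gE ρ j l')) 0
  | serre_F (i j : Fin n) (hij : i ≠ j) (l : Fin (1 - C.a i j).toNat → ℤ) (l' : ℤ) :
      LoopRel ρ (serreSum (v ^ C.r i) (1 - C.a i j).toNat (fun t => gF ρ i (l t)) (gF ρ j l')) 0

/-- The quantum loop algebra `U_v(L𝔤)`. -/
abbrev LoopAlg (ρ : Realization C 𝔥) : Type _ := RingQuot (LoopRel ρ)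

/-- The element `E_{i,l}` of `U_v(L𝔤)`. -/
def uE (ρ : Realization C 𝔥) (i : Fin n) (l : ℤ) : LoopAlg ρ :=
  RingQuot.mkAlgHom Kv (LoopRel ρ) (gE ρ i l)

/-- The element `H_{i,s}`, `s ≥ 1`, of `U_v(L𝔤)`. -/
def uH (ρ : Realization C 𝔥) (i : Fin n) (s : ℕ+) : LoopAlg ρ :=
  RingQuot.mkAlgHom Kv (LoopRel ρ) (gH ρ i (posIdx s))

/-- `U_v(L𝔫)`: the subalgebra of `U_v(L𝔤)` generated by all `E_{i,l}`. -/
def Un (ρ : Realization C 𝔥) : Subalgebra Kv (LoopAlg ρ) :=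
  Algebra.adjoin Kv {x | ∃ i l, x = uE ρ i l}

end LoopAlgebra

/-! ### Words in the generators of `U_v^+(L𝔤)` -/

/-- The generators `E_{i,l}`, `l ∈ ℤ`, and `H_{i,s}`, `s ≥ 1`, of `U_v^+(L𝔤)`. -/
inductive PosGen (n : ℕ) : Type
  | E (i : Fin n) (l : ℤ) : PosGen n
  | H (i : Fin n) (s : ℕ+) : PosGen n

/-- Words in the generators of `U_v^+(L𝔤)`. -/
abbrev Word (n : ℕ) : Type := FreeMonoid (PosGen n)

/-- The free algebra on the generators of `U_v^+(L𝔤)`, with the words as a basis. -/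
abbrev PosFree (n : ℕ) : Type := MonoidAlgebra Kv (Word n)

/-- A word as an element of the free algebra. -/
def word {n : ℕ} (w : Word n) : PosFree n := MonoidAlgebra.single w 1

def pE {n : ℕ} (i : Fin n) (l : ℤ) : PosFree n := word (FreeMonoid.of (PosGen.E i l))

def pH {n : ℕ} (i : Fin n) (s : ℕ+) : PosFree n := word (FreeMonoid.of (PosGen.H i s))

/-- `θ^+_{i,t}`: the coefficient of `z^t` in `exp ((v^{-1} - v) ∑_{s ≥ 1} H_{i,s} z^s)`. -/
def theta {n : ℕ} (i : Fin n) (t : ℕ) : PosFree n := expCoeff (v⁻¹ - v) (fun s => pH i s) t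

/-- The free algebra on the `E_{i,l}` alone. -/
def EFree (n : ℕ) : Subalgebra Kv (PosFree n) :=
  Algebra.adjoin Kv {x | ∃ i l, x = pE i l}

/-- The weight in `Q = ℤ^I` of a generator: `wt E_{i,l} = α_i` and `wt H_{i,s} = 0`. -/
def genWt {n : ℕ} : PosGen n → (Fin n → ℤ)
  | PosGen.E i _ => Pi.single i 1
  | PosGen.H _ _ => 0

/-- The weight of a word. -/
def wt {n : ℕ} (w : Word n) : Fin n → ℤ := (w.toList.map genWt).sum

theorem wt_one {n : ℕ} : wt (1 : Word n) = 0 := by simp [wt]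

theorem wt_mul {n : ℕ} (w w' : Word n) : wt (w * w') = wt w + wt w' := by simp [wt]

/-- The bilinear form on `Q` with `(α_i, α_j) = b i j`. -/
def CartanDatum.form {n : ℕ} (C : CartanDatum n) (x y : Fin n → ℤ) : ℤ :=
  ∑ i, ∑ j, x i * C.b i j * y j

/-! ### The completed twisted tensor square of the free algebra

Its elements are arbitrary formal sums `∑ f (w₁, w₂) w₁ ⊗ w₂` over pairs of words. A pair of words
has only finitely many factorizations, so products of such sums make sense. -/

/-- The factorizations of a word into two words. -/
def splits {n : ℕ} (w : Word n) : Finset (Word n × Word n) := by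
  classical
  exact (Finset.range (w.toList.length + 1)).image fun k =>
    (FreeMonoid.ofList (w.toList.take k), FreeMonoid.ofList (w.toList.drop k))

theorem mem_splits {n : ℕ} (w : Word n) (p : Word n × Word n) :
    p ∈ splits w ↔ p.1 * p.2 = w := by
  classical
  unfold splits
  simp only [Finset.mem_image, Finset.mem_range]
  constructor
  · rintro ⟨k, -, rfl⟩
    exact List.take_append_drop k w.toList
  · rintro rfl
    refine ⟨p.1.toList.length, ?_, ?_⟩
    · simp
    · ext1 <;> simp

/-- The factorizations of a pair of words in `Word n × Word n`. -/
def splits₂ {n : ℕ} (m : Word n × Word n) : Finset ((Word n × Word n) × (Word n × Word n)) := by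
  classical
  exact (splits m.1 ×ˢ splits m.2).image fun q => ((q.1.1, q.2.1), (q.1.2, q.2.2))

theorem mem_splits₂ {n : ℕ} (m : Word n × Word n) (p : (Word n × Word n) × (Word n × Word n)) :
    p ∈ splits₂ m ↔ p.1 * p.2 = m := by
  classical
  unfold splits₂
  simp only [Finset.mem_image, Finset.mem_product, mem_splits, Prod.ext_iff, Prod.fst_mul,
    Prod.snd_mul]
  constructor
  · rintro ⟨q, ⟨h1, h2⟩, ⟨h3, h4⟩, h5, h6⟩
    rw [← h3, ← h4, ← h5, ← h6]
    exact ⟨h1, h2⟩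
  · rintro ⟨h1, h2⟩
    exact ⟨((p.1.1, p.2.1), (p.1.2, p.2.2)), ⟨h1, h2⟩, ⟨rfl, rfl⟩, rfl, rfl⟩

/-- The completed tensor square. -/
def CTensor {n : ℕ} (_C : CartanDatum n) : Type := Word n × Word n → Kv

/-- The twist `v^{-(wt x₂, wt y₁)}` in the product `(x₁ ⊗ x₂) (y₁ ⊗ y₂)`. -/
def twist {n : ℕ} (C : CartanDatum n) (x y : Word n × Word n) : Kv :=
  v ^ (-C.form (wt x.2) (wt y.1))

namespace CTensor

variable {n : ℕ} {C : CartanDatum n}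

instance : AddCommGroup (CTensor C) := inferInstanceAs (AddCommGroup (Word n × Word n → Kv))

instance : Module Kv (CTensor C) := inferInstanceAs (Module Kv (Word n × Word n → Kv))

/-- The coefficient of `w₁ ⊗ w₂`. -/
def coeff (f : CTensor C) (m : Word n × Word n) : Kv := f m

@[ext] theorem ext {f g : CTensor C} (h : ∀ m, f.coeff m = g.coeff m) : f = g := funext h

@[simp] theorem coeff_add (f g : CTensor C) (m) : (f + g).coeff m = f.coeff m + g.coeff m := rfl
@[simp] theorem coeff_zero (m) : (0 : CTensor C).coeff m = 0 := rfl
@[simp] theorem coeff_smul (c : Kv) (f : CTensor C) (m) : (c • f).coeff m = c * f.coeff m := rfl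

/-- The tensor `x ⊗ y`. -/
def tmul (C : CartanDatum n) (x y : PosFree n) : CTensor C :=
  fun m => x.coeff m.1 * y.coeff m.2

instance : One (CTensor C) := ⟨tmul C 1 1⟩

/-- The product `(x₁ ⊗ x₂) (y₁ ⊗ y₂) = v^{-(wt x₂, wt y₁)} x₁ y₁ ⊗ x₂ y₂`. -/
instance : Mul (CTensor C) :=
  ⟨fun f g m => ∑ p ∈ splits₂ m, twist C p.1 p.2 * (f.coeff p.1 * g.coeff p.2)⟩

theorem coeff_mul (f g : CTensor C) (m : Word n × Word n) :
    (f * g).coeff m = ∑ p ∈ splits₂ m, twist C p.1 p.2 * (f.coeff p.1 * g.coeff p.2) := rfl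

theorem coeff_one_one : (1 : CTensor C).coeff 1 = 1 := by
  classical
  change (1 : PosFree n).coeff 1 * (1 : PosFree n).coeff 1 = _
  rw [MonoidAlgebra.one_def]
  simp

theorem coeff_one_of_ne {m : Word n × Word n} (h : m ≠ 1) : (1 : CTensor C).coeff m = 0 := by
  classical
  change (1 : PosFree n).coeff m.1 * (1 : PosFree n).coeff m.2 = _
  rw [MonoidAlgebra.one_def, mul_eq_zero]
  simp only [MonoidAlgebra.coeff_single, Finsupp.single_apply]
  by_contra hc
  push Not at hc
  apply h
  have h1 : 1 = m.1 := by
    by_contra h1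
    exact hc.1 (if_neg h1)
  have h2 : 1 = m.2 := by
    by_contra h2
    exact hc.2 (if_neg h2)
  exact Prod.ext h1.symm h2.symm

theorem twist_one_left (y : Word n × Word n) : twist C 1 y = 1 := by
  simp [twist, wt_one, CartanDatum.form]

theorem twist_one_right (x : Word n × Word n) : twist C x 1 = 1 := by
  simp [twist, wt_one, CartanDatum.form]

theorem v_ne_zero : v ≠ 0 := RatFunc.X_ne_zero

theorem twist_mul_left (x y z : Word n × Word n) :
    twist C (x * y) z = twist C x z * twist C y z := by
  unfold twist
  rw [← zpow_add₀ v_ne_zero]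
  congr 1
  simp only [CartanDatum.form, Prod.snd_mul, wt_mul, Pi.add_apply, add_mul,
    Finset.sum_add_distrib]
  ring

theorem twist_mul_right (x y z : Word n × Word n) :
    twist C x (y * z) = twist C x y * twist C x z := by
  unfold twist
  rw [← zpow_add₀ v_ne_zero]
  congr 1
  simp only [CartanDatum.form, Prod.fst_mul, wt_mul, Pi.add_apply, mul_add,
    Finset.sum_add_distrib]
  ring

protected theorem one_mul (f : CTensor C) : 1 * f = f := by
  ext m
  rw [coeff_mul, Finset.sum_eq_single (1, m)]
  · simp [coeff_one_one, twist_one_left]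
  · rintro p hp hne
    rw [mem_splits₂] at hp
    rw [coeff_one_of_ne]
    · simp
    · intro h
      apply hne
      rw [h, _root_.one_mul] at hp
      exact Prod.ext h hp
  · intro h
    exact absurd ((mem_splits₂ _ _).2 (_root_.one_mul m)) h

protected theorem mul_one (f : CTensor C) : f * 1 = f := by
  ext m
  rw [coeff_mul, Finset.sum_eq_single (m, 1)]
  · simp [coeff_one_one, twist_one_right]
  · rintro p hp hne
    rw [mem_splits₂] at hp
    rw [coeff_one_of_ne]
    · simp
    · intro h
      apply hne
      rw [h, _root_.mul_one] at hp
      exact Prod.ext hp h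
  · intro h
    exact absurd ((mem_splits₂ _ _).2 (_root_.mul_one m)) h

protected theorem mul_assoc (f g h : CTensor C) : f * g * h = f * (g * h) := by
  ext m
  simp only [coeff_mul, Finset.sum_mul, Finset.mul_sum]
  rw [Finset.sum_sigma', Finset.sum_sigma']
  refine Finset.sum_bij' (fun x _ => ⟨(x.2.1, x.2.2 * x.1.2), (x.2.2, x.1.2)⟩)
    (fun x _ => ⟨(x.1.1 * x.2.1, x.2.2), (x.1.1, x.2.1)⟩) ?_ ?_ ?_ ?_ ?_
  · rintro ⟨⟨a, b⟩, ⟨c, d⟩⟩ hx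
    simp only [Finset.mem_sigma, mem_splits₂] at hx ⊢
    refine ⟨?_, trivial⟩
    rw [← hx.1, ← hx.2, _root_.mul_assoc]
  · rintro ⟨⟨a, b⟩, ⟨c, d⟩⟩ hx
    simp only [Finset.mem_sigma, mem_splits₂] at hx ⊢
    refine ⟨?_, trivial⟩
    rw [← hx.1, ← hx.2, _root_.mul_assoc]
  · rintro ⟨⟨a, b⟩, ⟨c, d⟩⟩ hx
    simp only [Finset.mem_sigma, mem_splits₂] at hx
    obtain ⟨-, rfl⟩ := hx
    rfl
  · rintro ⟨⟨a, b⟩, ⟨c, d⟩⟩ hx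
    simp only [Finset.mem_sigma, mem_splits₂] at hx
    obtain ⟨-, rfl⟩ := hx
    rfl
  · rintro ⟨⟨a, b⟩, ⟨c, d⟩⟩ hx
    simp only [Finset.mem_sigma, mem_splits₂] at hx
    obtain ⟨-, rfl⟩ := hx
    simp only [twist_mul_left, twist_mul_right]
    ring

instance : Ring (CTensor C) :=
  { (inferInstance : AddCommGroup (CTensor C)), (inferInstance : One (CTensor C)),
    (inferInstance : Mul (CTensor C)) with
    one_mul := CTensor.one_mul
    mul_one := CTensor.mul_one
    mul_assoc := CTensor.mul_assoc
    left_distrib := fun f g h => by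
      ext m
      simp only [coeff_mul, coeff_add, mul_add, Finset.sum_add_distrib]
    right_distrib := fun f g h => by
      ext m
      simp only [coeff_mul, coeff_add, add_mul, mul_add, Finset.sum_add_distrib]
    zero_mul := fun f => by
      ext m
      simp [coeff_mul]
    mul_zero := fun f => by
      ext m
      simp [coeff_mul] }

instance : Algebra Kv (CTensor C) :=
  Algebra.ofModule
    (fun c f g => by
      ext m
      simp only [coeff_mul, coeff_smul, Finset.mul_sum]
      exact Finset.sum_congr rfl fun p _ => by ring)
    (fun c f g => by
      ext m
      simp only [coeff_mul, coeff_smul, Finset.mul_sum]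
      exact Finset.sum_congr rfl fun p _ => by ring)

end CTensor

/-! ### The coproduct `Δ'`, the Hopf pairing and the operators `F'_{i,n}` -/

section Coproduct

variable {n : ℕ}

/-- The infinite sum `∑_{t ≥ 0} θ^+_{i,t} ⊗ E_{i,l-t}`; at most one `t` contributes to the
coefficient of a given pair of words. -/
def thetaE (C : CartanDatum n) (i : Fin n) (l : ℤ) : CTensor C :=
  fun m => ∑ᶠ t : ℕ, (CTensor.tmul C (theta i t) (pE i (l - t))).coeff m

/-- `Δ'` on generators: `Δ'(E_{i,l}) = E_{i,l} ⊗ 1 + ∑_{t ≥ 0} θ^+_{i,t} ⊗ E_{i,l-t}`, and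
`Δ'(H_{i,s}) = H_{i,s} ⊗ 1 + 1 ⊗ H_{i,s}`, that is,
`Δ'(θ^+_{i,m}) = ∑_{0 ≤ t ≤ m} θ^+_{i,m-t} ⊗ θ^+_{i,t}` for all `m`. -/
def deltaGen (C : CartanDatum n) : PosGen n → CTensor C
  | PosGen.E i l => CTensor.tmul C (pE i l) 1 + thetaE C i l
  | PosGen.H i s => CTensor.tmul C (pH i s) 1 + CTensor.tmul C 1 (pH i s)

/-- The algebra homomorphism `Δ'`. -/
def delta (C : CartanDatum n) : PosFree n →ₐ[Kv] CTensor C :=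
  MonoidAlgebra.lift Kv (CTensor C) (Word n) (FreeMonoid.lift (deltaGen C))

/-- The value `(H_{i,s}, H_{j,t}) = δ_{s,t} [s b_{i,j}] / (s (v^{-1} - v))`. -/
def pairHH (C : CartanDatum n) (i : Fin n) (s : ℕ+) (j : Fin n) (t : ℕ+) : Kv :=
  if s = t then qInt v (((s : ℕ) : ℤ) * C.b i j) / (((s : ℕ) : Kv) * (v⁻¹ - v)) else 0

/-- The value `(E_{i,k}, E_{j,l}) = δ_{i,j} δ_{k,l} / (v^{-2} - 1)`. -/
def pairEE (i : Fin n) (k : ℤ) (j : Fin n) (l : ℤ) : Kv :=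
  if i = j ∧ k = l then (v ^ (-2 : ℤ) - 1)⁻¹ else 0

/-- The value `(w, E_{j,l})` for a word `w`, given by the values on generators and
`(x y, E_{j,l}) = (x ⊗ y, Δ'(E_{j,l}))`. Here `(H_{i,s}, θ^+_{j,t})` is
`δ_{s,t} (v^{-1} - v) (H_{i,s}, H_{j,s})`, because `H_{i,s}` is primitive and hence orthogonal to
products of elements of the augmentation ideal. -/
def pairE (C : CartanDatum n) (j : Fin n) : ℤ → List (PosGen n) → Kv
  | _, [] => 0
  | l, [PosGen.E i k] => pairEE i k j l
  | _, PosGen.E _ _ :: _ :: _ => 0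
  | l, PosGen.H i s :: w => (v⁻¹ - v) * pairHH C i s j s * pairE C j (l - ((s : ℕ) : ℤ)) w

/-- The value `(w, H_{j,t})` for a word `w`, given by the values on generators and
`(x y, H_{j,t}) = (x ⊗ y, Δ'(H_{j,t}))`. -/
def pairH (C : CartanDatum n) (j : Fin n) (t : ℕ+) : List (PosGen n) → Kv
  | [PosGen.H i s] => pairHH C i s j t
  | _ => 0

/-- The value `(w, g)` for a word `w` and a generator `g`. -/
def pairGen (C : CartanDatum n) (w : Word n) : PosGen n → Kv
  | PosGen.E j l => pairE C j l w.toList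
  | PosGen.H j t => pairH C j t w.toList

/-- The value `(x, y)` of the Hopf pairing on words: `(x, 1) = ε(x)` and
`(x, g y) = (Δ'(x), g ⊗ y)` for a generator `g`, where `(x₁ ⊗ x₂, g ⊗ y) = (x₁, g) (x₂, y)`. -/
def pairWord (C : CartanDatum n) : List (PosGen n) → Word n → Kv
  | [], x => if x.toList = [] then 1 else 0
  | g :: y, x => ∑ᶠ m : Word n × Word n,
      (delta C (word x)).coeff m * (pairGen C m.1 g * pairWord C y m.2)

/-- The Hopf pairing as a bilinear form `(x, y)` on the free algebra. -/
def pairing (C : CartanDatum n) (x y : PosFree n) : Kv :=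
  x.coeff.sum fun a c => y.coeff.sum fun b d => c * d * pairWord C b.toList a

/-- `F'_{i,k}(x) = ∑ (v^{-2} - 1) (E_{i,k}, x_{(1)}) x_{(2)}`, where
`Δ'(x) = ∑ x_{(1)} ⊗ x_{(2)}`. -/
def Fprime (C : CartanDatum n) (i : Fin n) (k : ℤ) (x : PosFree n) : PosFree n :=
  ∑ᶠ m : Word n × Word n, ((v ^ (-2 : ℤ) - 1) *
    (pairing C (pE i k) (word m.1) * (delta C x).coeff m)) • word m.2

end Coproduct

/-! ### Passing to `U_v(L𝔫)` -/

section Descent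

variable {n : ℕ} {C : CartanDatum n} {𝔥 : Type*} [AddCommGroup 𝔥] [Module ℂ 𝔥]

/-- The canonical homomorphism from the free algebra to `U_v(L𝔤)`. Its image is `U_v^+(L𝔤)`, and
the image of `EFree n` is `U_v(L𝔫)`. -/
def proj (ρ : Realization C 𝔥) : PosFree n →ₐ[Kv] LoopAlg ρ :=
  MonoidAlgebra.lift Kv (LoopAlg ρ) (Word n) (FreeMonoid.lift fun g =>
    match g with
    | PosGen.E i l => uE ρ i l
    | PosGen.H i s => uH ρ i s)

/-- `F k u = F'_{i,k}(u)` for all `k ∈ ℤ` and `u ∈ U_v(L𝔫)`: the operators `F k` on `U_v(L𝔫)` are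
given by the formula `u ↦ ∑ (v^{-2} - 1) (E_{i,k}, u_{(1)}) u_{(2)}`, computed on any expression `x`
of `u` through the generators `E_{j,l}`. -/
def IsFprime (ρ : Realization C 𝔥) (i : Fin n) (F : ℤ → Module.End Kv (Un ρ)) : Prop :=
  ∀ x ∈ EFree n, ∀ u : Un ρ, (u : LoopAlg ρ) = proj ρ x →
    ∀ k : ℤ, (F k u : LoopAlg ρ) = proj ρ (Fprime C i k x)

/-- `Z'_{i,k}`, the common kernel of the `F'_{i,m}` with `m ≤ k`: the elements of `U_v(L𝔫)` with an
expression `x` through the generators `E_{j,l}` such that `∑ (v^{-2} - 1) (E_{i,m}, x_{(1)}) x_{(2)}`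
vanishes in `U_v(L𝔤)` for all `m ≤ k`. -/
def Zprime (ρ : Realization C 𝔥) (i : Fin n) (k : ℤ) : Set (Un ρ) :=
  {u | ∃ x ∈ EFree n, proj ρ x = u ∧ ∀ m ≤ k, proj ρ (Fprime C i m x) = 0}

end Descent

end QLoop

end

/-!
Since `Δ'(E_{i,m}) = E_{i,m} ⊗ 1 + ∑_{t ≥ 0} θ^+_{i,t} ⊗ E_{i,m-t}`, pairing a product with
`E_{i,m}` gives the Leibniz rule
`F'_{i,m}(x y) = F'_{i,m}(x) y + ∑_{t ≥ 0} Θ_t(x) F'_{i,m-t}(y)`,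
where `Θ_t` contracts the left factor of `Δ'(x)` with `θ^+_{i,t}`. Every operator that it applies to
`y` is some `F'_{i,m'}` with `m' ≤ m`, so the common kernel over all `m ≤ k` is closed under
products. The sum is finite because the left factors of the terms of `Δ'(y)` have `ℤ`-degrees
bounded below, whereas `F'_{i,m-t}` only sees left factors of degree `m - t`.
-/

noncomputable section

namespace QLoop

section Grading

variable {n : ℕ} {M : Type*} [AddMonoid M] {f : PosGen n → M}

/-- The degree of a word for the grading that gives each generator `g` the degree `f g`;
`wt` is `grade genWt`. -/
def grade (f : PosGen n → M) (w : Word n) : M := (w.toList.map f).sum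

theorem grade_one : grade f 1 = 0 := rfl

theorem grade_mul (w w' : Word n) : grade f (w * w') = grade f w + grade f w' := by simp [grade]

theorem grade_of (g : PosGen n) : grade f (FreeMonoid.of g) = f g := by simp [grade]

theorem coeff_word_self (w : Word n) : (word w).coeff w = 1 := by
  rw [word, MonoidAlgebra.coeff_single, Finsupp.single_eq_same]

theorem coeff_word_ne_zero {w w' : Word n} : (word w).coeff w' ≠ 0 ↔ w' = w := by
  rw [word, MonoidAlgebra.coeff_single, Finsupp.single_apply_ne_zero]
  exact and_iff_left one_ne_zero

theorem word_mul (w w' : Word n) : word (w * w') = word w * word w' :=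
  map_mul (MonoidAlgebra.of Kv (Word n)) w w'

theorem posFree_induction {motive : PosFree n → Prop} (x : PosFree n) (one : motive 1)
    (word_of_mul : ∀ g x, motive x → motive (word (FreeMonoid.of g) * x))
    (add : ∀ x y, motive x → motive y → motive (x + y))
    (smul : ∀ (c : Kv) x, motive x → motive (c • x)) : motive x := by
  induction x using MonoidAlgebra.induction_on with
  | of w =>
    change motive (word w)
    induction w using FreeMonoid.inductionOn' with
    | one => exact one
    | of_mul g w ih => exact word_mul (FreeMonoid.of g) w ▸ word_of_mul g _ ih
  | add x y hx hy => exact add x y hx hy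
  | smul c x hx => exact smul c x hx

/-- The homogeneous component of degree `d` of the free algebra, for the grading `grade f`. -/
def homogeneous (f : PosGen n → M) (d : M) : Submodule Kv (PosFree n) where
  carrier := {x | ∀ w, x.coeff w ≠ 0 → grade f w = d}
  zero_mem' := fun _ hw => absurd rfl hw
  add_mem' := by
    intro x y hx hy w hw
    by_cases h : x.coeff w = 0
    · exact hy w fun h' => hw (by simp [h, h'])
    · exact hx w h
  smul_mem' := fun c x hx w hw => hx w fun h => hw (by simp [h])

theorem word_mem_homogeneous (w : Word n) : word w ∈ homogeneous f (grade f w) := by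
  intro w' hw'
  rw [coeff_word_ne_zero.1 hw']

theorem pH_mem_homogeneous (i : Fin n) (s : ℕ+) : pH i s ∈ homogeneous f (f (.H i s)) :=
  grade_of (f := f) (PosGen.H i s) ▸ word_mem_homogeneous _

instance : SetLike.GradedMonoid (homogeneous f) where
  one_mem := word_mem_homogeneous 1
  mul_mem := by
    classical
    intro a b x y hx hy w hw
    rw [MonoidAlgebra.coeff_mul_antidiag _ _ _ _ fun {p} => mem_splits w p] at hw
    obtain ⟨p, hp, hne⟩ := Finset.exists_ne_zero_of_sum_ne_zero hw
    rw [← (mem_splits w p).1 hp, grade_mul, hx _ (left_ne_zero_of_mul hne),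
      hy _ (right_ne_zero_of_mul hne)]

/-- The `ℤ`-valued degree of a generator: `l` for `E_{i,l}` and `s` for `H_{i,s}`. -/
def genDeg : PosGen n → ℤ
  | PosGen.E _ l => l
  | PosGen.H _ s => (s : ℕ)

/-- The `ℤ`-valued degree of a word. -/
abbrev deg (w : Word n) : ℤ := grade genDeg w

theorem deg_of_mul (g : PosGen n) (w : Word n) :
    deg (FreeMonoid.of g * w) = genDeg g + deg w := by
  rw [deg, grade_mul, grade_of]

end Grading

section Theta

variable {n : ℕ} {M : Type*} [AddCommMonoid M] {f : PosGen n → M}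

theorem coeff_pow_mem_graded {A σ : Type*} [Semiring A] [SetLike σ A]
    [AddSubmonoidClass σ A] {𝒜 : M → σ} [SetLike.GradedMonoid 𝒜] {a b : M} {f : PowerSeries A}
    (hf : ∀ t, PowerSeries.coeff t f ∈ 𝒜 (a + t • b)) (k t : ℕ) :
    PowerSeries.coeff t (f ^ k) ∈ 𝒜 (k • a + t • b) := by
  induction k generalizing t with
  | zero =>
    rw [pow_zero, PowerSeries.coeff_one]
    split_ifs with h
    · simpa only [h, zero_smul, add_zero] using SetLike.GradedOne.one_mem (A := 𝒜)
    · exact zero_mem _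
  | succ k ih =>
    rw [pow_succ, PowerSeries.coeff_mul]
    refine sum_mem fun p hp => ?_
    have hdeg : (k + 1) • a + t • b = (k • a + p.1 • b) + (a + p.2 • b) := by
      rw [← Finset.HasAntidiagonal.mem_antidiagonal.1 hp, add_smul, add_smul, one_smul,
        add_add_add_comm]
    rw [hdeg]
    exact SetLike.GradedMul.mul_mem (ih _) (hf _)

/-- The exponent `(v^{-1} - v) ∑_{s ≥ 1} H_{i,s} z^s` of the generating series of the
`θ^+_{i,t}`. -/
def thetaExponent (i : Fin n) : PowerSeries (PosFree n) :=
  PowerSeries.mk fun s : ℕ => if h : 0 < s then (v⁻¹ - v) • pH i ⟨s, h⟩ else 0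

theorem theta_eq_sum (i : Fin n) (t : ℕ) :
    theta i t = ∑ k ∈ Finset.range (t + 1),
      ((k.factorial : Kv)⁻¹) • PowerSeries.coeff t (thetaExponent i ^ k) := rfl

theorem coeff_thetaExponent_pow_mem_homogeneous {i : Fin n} {a b : M}
    (hf : ∀ s : ℕ+, f (.H i s) = a + (s : ℕ) • b) (k t : ℕ) :
    PowerSeries.coeff t (thetaExponent i ^ k) ∈ homogeneous f (k • a + t • b) := by
  refine coeff_pow_mem_graded (fun s => ?_) k t
  rw [thetaExponent, PowerSeries.coeff_mk]
  split_ifs with hs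
  · exact Submodule.smul_mem _ _ (hf ⟨s, hs⟩ ▸ pH_mem_homogeneous i ⟨s, hs⟩)
  · exact zero_mem _

theorem theta_mem_homogeneous {i : Fin n} {b : M} (hf : ∀ s : ℕ+, f (.H i s) = (s : ℕ) • b)
    (t : ℕ) : theta i t ∈ homogeneous f (t • b) := by
  rw [theta_eq_sum]
  refine sum_mem fun k _ => Submodule.smul_mem _ _ ?_
  simpa only [smul_zero, zero_add] using
    coeff_thetaExponent_pow_mem_homogeneous (fun s => (hf s).trans (zero_add _).symm) k t

theorem theta_zero (i : Fin n) : theta i 0 = 1 := by simp [theta, expCoeff]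

theorem coeff_theta_of (i : Fin n) (s : ℕ+) (g : PosGen n) :
    (theta i s).coeff (FreeMonoid.of g) = (v⁻¹ - v) * (pH i s).coeff (FreeMonoid.of g) := by
  have hlength (k : ℕ) (hk : k ≠ 1) :
      (PowerSeries.coeff (s : ℕ) (thetaExponent i ^ k)).coeff (FreeMonoid.of g) = 0 := by
    by_contra h
    have hdeg := coeff_thetaExponent_pow_mem_homogeneous (f := fun _ => (1 : ℕ)) (a := 1) (b := 0)
      (fun _ => by rw [smul_zero, add_zero]) k s _ h
    rw [grade_of, smul_zero, add_zero, smul_eq_mul, mul_one] at hdeg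
    exact hk hdeg.symm
  rw [theta_eq_sum, MonoidAlgebra.coeff_sum, Finsupp.finsetSum_apply,
    Finset.sum_eq_single 1 (fun k _ hk => by simp [hlength k hk])
      (fun h => absurd (Finset.mem_range.2 (Nat.succ_lt_succ s.pos)) h)]
  have hs : PowerSeries.coeff (s : ℕ) (thetaExponent i) = (v⁻¹ - v) • pH i s := by
    rw [thetaExponent, PowerSeries.coeff_mk, dif_pos s.pos]
    rfl
  rw [Nat.factorial_one, Nat.cast_one, inv_one, one_smul, pow_one, hs]
  rfl

theorem wt_eq_zero_of_coeff_theta {i : Fin n} {t : ℕ} {w : Word n}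
    (hw : (theta i t).coeff w ≠ 0) : wt w = 0 :=
  (theta_mem_homogeneous (f := genWt) (b := 0) (fun _ => (smul_zero _).symm) t w hw).trans
    (smul_zero t)

theorem deg_of_coeff_theta {i : Fin n} {t : ℕ} {w : Word n}
    (hw : (theta i t).coeff w ≠ 0) : deg w = t :=
  (theta_mem_homogeneous (f := genDeg) (b := 1) (fun s => by simp [genDeg]) t w hw).trans (by simp)

end Theta

section Pairing

variable {n : ℕ} {C : CartanDatum n}

theorem coeff_tmul (x y : PosFree n) (p : Word n × Word n) :
    (CTensor.tmul C x y).coeff p = x.coeff p.1 * y.coeff p.2 := rfl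

theorem coeff_tmul_word_ne_zero {w w' : Word n} {p : Word n × Word n} :
    (CTensor.tmul C (word w) (word w')).coeff p ≠ 0 ↔ p = (w, w') := by
  rw [coeff_tmul, mul_ne_zero_iff, coeff_word_ne_zero, coeff_word_ne_zero, Prod.ext_iff]

theorem exists_of_coeff_thetaE_ne_zero {i : Fin n} {l : ℤ} {p : Word n × Word n}
    (hp : (thetaE C i l).coeff p ≠ 0) :
    ∃ t : ℕ, (theta i t).coeff p.1 ≠ 0 ∧ p.2 = FreeMonoid.of (PosGen.E i (l - t)) := by
  obtain ⟨t, ht⟩ : ∃ t : ℕ, (CTensor.tmul C (theta i t) (pE i (l - t))).coeff p ≠ 0 := by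
    by_contra! h
    exact hp (finsum_eq_zero_of_forall_eq_zero h)
  rw [coeff_tmul] at ht
  exact ⟨t, left_ne_zero_of_mul ht, coeff_word_ne_zero.1 (right_ne_zero_of_mul ht)⟩

theorem coeff_thetaE_of (i : Fin n) (l : ℤ) (w : Word n) (t : ℕ) :
    (thetaE C i l).coeff (w, FreeMonoid.of (PosGen.E i (l - t))) = (theta i t).coeff w := by
  refine (finsum_eq_single _ t fun s hs => ?_).trans ?_
  · by_contra h
    rw [coeff_tmul, pE] at h
    have hE := coeff_word_ne_zero.1 (right_ne_zero_of_mul h)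
    simp only [FreeMonoid.of_injective.eq_iff, PosGen.E.injEq, true_and] at hE
    omega
  · rw [coeff_tmul, pE, coeff_word_self, mul_one]

theorem delta_word_of (g : PosGen n) : delta C (word (FreeMonoid.of g)) = deltaGen C g := by
  rw [delta, word, MonoidAlgebra.lift_single, one_smul, FreeMonoid.lift_eval_of]

/-- The counit of the free algebra, on words. -/
def counit : Word n →* Kv := FreeMonoid.lift fun _ => 0

theorem eq_one_of_counit_ne_zero {w : Word n} (hw : counit w ≠ 0) : w = 1 := by
  cases w using FreeMonoid.casesOn with
  | one => rfl
  | of_mul g w => exact absurd (by simp [counit]) hw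

theorem counit_of_mul (g : PosGen n) (w : Word n) : counit (FreeMonoid.of g * w) = 0 := by
  simp [counit]

/-- The character `w ↦ (w, θ^+_{i,t})`, where `t` is the degree of `w`, of the monoid of words. It
is multiplicative because the generating series of the `θ^+_{i,t}` is group-like. -/
def thetaChar (C : CartanDatum n) (i : Fin n) : Word n →* Kv :=
  FreeMonoid.lift fun
    | PosGen.E _ _ => 0
    | PosGen.H j s => (v⁻¹ - v) * pairHH C j s i s

theorem thetaChar_E (i j : Fin n) (l : ℤ) :
    thetaChar C i (FreeMonoid.of (PosGen.E j l)) = 0 := by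
  rw [thetaChar, FreeMonoid.lift_eval_of]

theorem thetaChar_H (i j : Fin n) (s : ℕ+) :
    thetaChar C i (FreeMonoid.of (PosGen.H j s)) = (v⁻¹ - v) * pairHH C j s i s := by
  rw [thetaChar, FreeMonoid.lift_eval_of]

theorem deg_nonneg_of_thetaChar_ne_zero {i : Fin n} {w : Word n} (hw : thetaChar C i w ≠ 0) :
    0 ≤ deg w := by
  induction w using FreeMonoid.inductionOn' with
  | one => exact le_rfl
  | of_mul g w ih =>
    rw [map_mul] at hw
    rw [deg_of_mul]
    refine add_nonneg ?_ (ih (right_ne_zero_of_mul hw))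
    cases g with
    | E j l => exact absurd (thetaChar_E i j l) (left_ne_zero_of_mul hw)
    | H j s => exact Int.natCast_nonneg s

theorem pairEE_comm (i j : Fin n) (k l : ℤ) : pairEE i k j l = pairEE j l i k := by
  simp only [pairEE, eq_comm]

theorem pairHH_comm (i j : Fin n) (s t : ℕ+) : pairHH C i s j t = pairHH C j t i s := by
  have hb : C.b i j = C.b j i := C.symm i j
  unfold pairHH
  by_cases h : s = t
  · rw [h, hb]
  · rw [if_neg h, if_neg (Ne.symm h)]

theorem pairE_E_mul (i j : Fin n) (m k : ℤ) (w : Word n) :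
    pairE C i m (FreeMonoid.of (PosGen.E j k) * w).toList = pairEE j k i m * counit w := by
  cases w using FreeMonoid.casesOn with
  | one => exact (mul_one _).symm
  | of_mul g w => exact (mul_eq_zero_of_right _ (counit_of_mul g w)).symm

theorem pairE_H_mul (i j : Fin n) (m : ℤ) (s : ℕ+) (w : Word n) :
    pairE C i m (FreeMonoid.of (PosGen.H j s) * w).toList =
      thetaChar C i (FreeMonoid.of (PosGen.H j s)) * pairE C i (m - (s : ℕ)) w.toList := by
  rw [thetaChar_H]
  rfl

theorem wt_deg_of_pairE_ne_zero {i : Fin n} {m : ℤ} {w : Word n}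
    (hw : pairE C i m w.toList ≠ 0) : wt w = Pi.single i 1 ∧ deg w = m := by
  induction w using FreeMonoid.inductionOn' generalizing m with
  | one => exact absurd rfl hw
  | of_mul g w ih =>
    cases g with
    | E j k =>
      rw [pairE_E_mul] at hw
      obtain ⟨rfl, rfl⟩ : j = i ∧ k = m := by
        by_contra h
        exact left_ne_zero_of_mul hw (if_neg h)
      obtain rfl := eq_one_of_counit_ne_zero (right_ne_zero_of_mul hw)
      exact ⟨by simp [wt, genWt], by simp [deg, grade, genDeg]⟩
    | H j s =>
      rw [pairE_H_mul] at hw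
      obtain ⟨hwt, hdeg⟩ := ih (right_ne_zero_of_mul hw)
      refine ⟨?_, ?_⟩
      · rw [wt_mul, hwt, add_eq_right]
        exact grade_of (f := genWt) (PosGen.H j s)
      · rw [deg_of_mul, hdeg, genDeg, add_sub_cancel]

/-- On words, this is `(u w, E_{i,m}) = (u ⊗ w, Δ'(E_{i,m}))`. -/
theorem pairE_mul (i : Fin n) (m : ℤ) (u w : Word n) :
    pairE C i m (u * w).toList =
      pairE C i m u.toList * counit w + thetaChar C i u * pairE C i (m - deg u) w.toList := by
  induction u using FreeMonoid.inductionOn' generalizing m with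
  | one => simp [pairE, grade_one]
  | of_mul g u ih =>
    cases g with
    | E j k =>
      rw [mul_assoc, pairE_E_mul, pairE_E_mul, map_mul, map_mul, thetaChar_E]
      ring
    | H j s =>
      rw [mul_assoc, pairE_H_mul, pairE_H_mul, ih, map_mul, deg_of_mul, genDeg,
        sub_add_eq_sub_sub]
      ring

theorem pairWord_one (w : Word n) : pairWord C w.toList 1 = counit w := by
  cases w using FreeMonoid.casesOn with
  | one => exact if_pos rfl
  | of_mul g w =>
    rw [counit_of_mul]
    refine finsum_eq_zero_of_forall_eq_zero fun p => ?_
    by_cases hp : p = 1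
    · cases g <;> simp [hp, pairGen, pairE, pairH]
    · change (delta C 1).coeff p * _ = 0
      rw [map_one, CTensor.coeff_one_of_ne hp, zero_mul]

theorem eq_of_pairH_ne_zero {j : Fin n} {s : ℕ+} {w : Word n} (hw : pairH C j s w.toList ≠ 0) :
    ∃ i, w = FreeMonoid.of (PosGen.H i s) := by
  cases w using FreeMonoid.casesOn with
  | one => exact absurd rfl hw
  | of_mul g w =>
    cases w using FreeMonoid.casesOn with
    | of_mul g' w => cases g <;> exact absurd rfl hw
    | one =>
      cases g with
      | E i l => exact absurd rfl hw
      | H i t =>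
        obtain rfl : t = s := by
          by_contra h
          exact hw (if_neg h)
        exact ⟨i, mul_one _⟩

theorem pairWord_E_cons (i j : Fin n) (m k : ℤ) (y : List (PosGen n)) :
    pairWord C (PosGen.E j k :: y) (FreeMonoid.of (PosGen.E i m)) =
      pairEE i m j k * pairWord C y 1 := by
  set p₀ : Word n × Word n := (FreeMonoid.of (PosGen.E i m), 1)
  have hcoeff : (deltaGen C (.E i m)).coeff p₀ = 1 := by
    have hθ : (thetaE C i m).coeff p₀ = 0 := by
      by_contra h
      obtain ⟨t, -, ht⟩ := exists_of_coeff_thetaE_ne_zero h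
      exact FreeMonoid.of_ne_one _ ht.symm
    rw [deltaGen, CTensor.coeff_add, hθ, add_zero, coeff_tmul, pE, coeff_word_self, one_mul]
    exact coeff_word_self 1
  rw [pairWord, finsum_eq_single _ p₀ fun p hp => ?_, delta_word_of, hcoeff, one_mul]
  · rfl
  by_contra h
  have hpair : pairE C j k p.1.toList ≠ 0 := left_ne_zero_of_mul (right_ne_zero_of_mul h)
  have hΔ := left_ne_zero_of_mul h
  rw [delta_word_of, deltaGen, CTensor.coeff_add] at hΔ
  have hθ : (thetaE C i m).coeff p = 0 := by
    by_contra hθ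
    obtain ⟨t, ht, -⟩ := exists_of_coeff_thetaE_ne_zero hθ
    have hwt := (wt_deg_of_pairE_ne_zero hpair).1
    rw [wt_eq_zero_of_coeff_theta ht, eq_comm, Pi.single_eq_zero_iff] at hwt
    exact one_ne_zero hwt
  rw [hθ, add_zero] at hΔ
  exact hp (coeff_tmul_word_ne_zero.1 hΔ)

theorem pairWord_H_cons (i j : Fin n) (m : ℤ) (s : ℕ+) (y : List (PosGen n)) :
    pairWord C (PosGen.H j s :: y) (FreeMonoid.of (PosGen.E i m)) =
      (v⁻¹ - v) * pairHH C i s j s *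
        pairWord C y (FreeMonoid.of (PosGen.E i (m - (s : ℕ)))) := by
  set p₀ : Word n × Word n :=
    (FreeMonoid.of (PosGen.H i s), FreeMonoid.of (PosGen.E i (m - (s : ℕ))))
  have hleft {j' : Fin n} {w : Word n} :
      (CTensor.tmul C (pE i m) 1).coeff (FreeMonoid.of (PosGen.H j' s), w) = 0 := by
    by_contra h
    have hE : FreeMonoid.of (PosGen.H j' s) = FreeMonoid.of (PosGen.E i m) :=
      (Prod.ext_iff.1 (coeff_tmul_word_ne_zero.1 h)).1
    exact nomatch FreeMonoid.of_injective hE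
  have hcoeff : (deltaGen C (.E i m)).coeff p₀ = v⁻¹ - v := by
    rw [deltaGen, CTensor.coeff_add, hleft, zero_add, coeff_thetaE_of, coeff_theta_of, pH,
      coeff_word_self, mul_one]
  rw [pairWord, finsum_eq_single _ p₀ fun p hp => ?_, delta_word_of, hcoeff, mul_assoc]
  · rfl
  by_contra h
  obtain ⟨j', hj'⟩ := eq_of_pairH_ne_zero (left_ne_zero_of_mul (right_ne_zero_of_mul h))
  obtain ⟨p₁, p₂⟩ := p
  obtain rfl : p₁ = _ := hj'
  have hΔ := left_ne_zero_of_mul h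
  rw [delta_word_of, deltaGen, CTensor.coeff_add, hleft, zero_add] at hΔ
  obtain ⟨t, ht, rfl⟩ := exists_of_coeff_thetaE_ne_zero hΔ
  obtain rfl : (s : ℕ) = t := by
    have hdeg := deg_of_coeff_theta ht
    rw [deg, grade_of, genDeg] at hdeg
    exact_mod_cast hdeg
  rw [coeff_theta_of] at ht
  exact hp (by rw [coeff_word_ne_zero.1 (right_ne_zero_of_mul ht)])

theorem pairWord_of_E (i : Fin n) (m : ℤ) (w : Word n) :
    pairWord C w.toList (FreeMonoid.of (PosGen.E i m)) = pairE C i m w.toList := by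
  induction w using FreeMonoid.inductionOn' generalizing m with
  | one => exact if_neg (List.cons_ne_nil _ _)
  | of_mul g w ih =>
    cases g with
    | E j k =>
      rw [pairE_E_mul, ← pairWord_one (C := C), pairEE_comm]
      exact pairWord_E_cons i j m k w.toList
    | H j s =>
      rw [pairE_H_mul, ← ih, thetaChar_H, pairHH_comm]
      exact pairWord_H_cons i j m s w.toList

theorem pairing_pE_word (i : Fin n) (m : ℤ) (w : Word n) :
    pairing C (pE i m) (word w) = pairE C i m w.toList := by
  simp [pairing, pE, word, MonoidAlgebra.coeff_single, pairWord_of_E]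

end Pairing

section Contraction

variable {n : ℕ} {C : CartanDatum n}

/-- The contraction `∑ ψ(x_{(1)}, x_{(2)}) x_{(2)}` of `f = ∑ x_{(1)} ⊗ x_{(2)}`. If infinitely many
terms are nonzero, its value is the junk value `0`. -/
def contraction (ψ : Word n × Word n → Kv) (f : CTensor C) : PosFree n :=
  ∑ᶠ p, (ψ p * f.coeff p) • word p.2

theorem contraction_eq_mapDomain {ψ : Word n × Word n → Kv} {f : CTensor C}
    {F : MonoidAlgebra Kv (Word n × Word n)} (hF : ∀ p, F.coeff p = ψ p * f.coeff p) :
    contraction ψ f = MonoidAlgebra.mapDomainRingHom Kv (MonoidHom.snd (Word n) (Word n)) F := by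
  have hsupport : (Function.support fun p => (ψ p * f.coeff p) • word p.2) ⊆ F.coeff.support :=
    fun p hp => Finsupp.mem_support_iff.2 (hF p ▸ left_ne_zero_of_smul hp)
  rw [contraction, finsum_eq_sum_of_support_subset _ hsupport]
  conv_rhs => rw [← MonoidAlgebra.sum_coeff_single F, Finsupp.sum, map_sum]
  refine Finset.sum_congr rfl fun p _ => ?_
  simp [hF, word]

theorem contraction_add {ψ : Word n × Word n → Kv} {f g : CTensor C}
    (hf : (fun p => ψ p * f.coeff p).HasFiniteSupport)
    (hg : (fun p => ψ p * g.coeff p).HasFiniteSupport) :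
    contraction ψ (f + g) = contraction ψ f + contraction ψ g := by
  simp only [contraction, CTensor.coeff_add, mul_add, add_smul]
  exact finsum_add_distrib (hf.subset fun _ => left_ne_zero_of_smul)
    (hg.subset fun _ => left_ne_zero_of_smul)

theorem contraction_smul (ψ : Word n × Word n → Kv) (c : Kv) (f : CTensor C) :
    contraction ψ (c • f) = c • contraction ψ f := by
  simp only [contraction, CTensor.coeff_smul, smul_finsum, smul_smul, mul_left_comm]

theorem contraction_mul {ι : Type*} {T : Finset ι} {ψ : Word n × Word n → Kv}
    {α β : ι → Word n × Word n → Kv} {f g : CTensor C}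
    (hf : ∀ a, (fun p => α a p * f.coeff p).HasFiniteSupport)
    (hg : ∀ a, (fun p => β a p * g.coeff p).HasFiniteSupport)
    (hψ : ∀ p q, f.coeff p ≠ 0 → g.coeff q ≠ 0 →
      ψ (p * q) * twist C p q = ∑ a ∈ T, α a p * β a q) :
    contraction ψ (f * g) = ∑ a ∈ T, contraction (α a) f * contraction (β a) g := by
  let F (a : ι) : MonoidAlgebra Kv (Word n × Word n) := .ofCoeff (Finsupp.ofSupportFinite _ (hf a))
  let G (a : ι) : MonoidAlgebra Kv (Word n × Word n) := .ofCoeff (Finsupp.ofSupportFinite _ (hg a))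
  have hFG (m) : (∑ a ∈ T, F a * G a).coeff m = ψ m * (f * g).coeff m := by
    simp only [MonoidAlgebra.coeff_sum, Finsupp.finsetSum_apply,
      MonoidAlgebra.coeff_mul_antidiag _ _ m (splits₂ m) (mem_splits₂ m _), CTensor.coeff_mul,
      Finset.mul_sum]
    rw [Finset.sum_comm]
    refine Finset.sum_congr rfl fun p hp => ?_
    by_cases hfg : f.coeff p.1 = 0 ∨ g.coeff p.2 = 0
    · rcases hfg with h | h <;> simp [F, G, Finsupp.ofSupportFinite, h]
    · push Not at hfg
      rw [← (mem_splits₂ m p).1 hp, ← mul_assoc, hψ _ _ hfg.1 hfg.2, Finset.sum_mul]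
      exact Finset.sum_congr rfl fun a _ => mul_mul_mul_comm _ _ _ _
  rw [contraction_eq_mapDomain hFG, map_sum]
  refine Finset.sum_congr rfl fun a _ => ?_
  rw [map_mul, contraction_eq_mapDomain (F := F a) fun _ => rfl,
    contraction_eq_mapDomain (F := G a) fun _ => rfl]

end Contraction

section LeftFinite

variable {n : ℕ} {C : CartanDatum n}

theorem exists_le_deg {f : CTensor C}
    (hf : ∀ M : ℤ, {p | f.coeff p ≠ 0 ∧ deg p.1 ≤ M}.Finite) :
    ∃ B : ℤ, ∀ p, f.coeff p ≠ 0 → B ≤ deg p.1 := by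
  obtain ⟨B, hB⟩ := ((hf 0).image fun p => deg p.1).bddBelow
  refine ⟨min B 0, fun p hp => ?_⟩
  rcases le_total (deg p.1) 0 with h | h
  · exact min_le_of_left_le (hB ⟨p, ⟨hp, h⟩, rfl⟩)
  · exact min_le_of_right_le h

/-- The elements `∑ x_{(1)} ⊗ x_{(2)}` of the completed tensor square that have only finitely many
terms with `deg x_{(1)} ≤ M`, for every `M`. It contains the image of `Δ'`. -/
def leftFinite (C : CartanDatum n) : Subalgebra Kv (CTensor C) where
  carrier := {f | ∀ M : ℤ, {p | f.coeff p ≠ 0 ∧ deg p.1 ≤ M}.Finite}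
  mul_mem' := by
    intro f g hf hg M
    obtain ⟨A, hA⟩ := exists_le_deg hf
    obtain ⟨B, hB⟩ := exists_le_deg hg
    refine ((hf (M - B)).image2 (· * ·) (hg (M - A))).subset fun m ⟨hm, hM⟩ => ?_
    rw [CTensor.coeff_mul] at hm
    obtain ⟨p, hp, hne⟩ := Finset.exists_ne_zero_of_sum_ne_zero hm
    have hfp := left_ne_zero_of_mul (right_ne_zero_of_mul hne)
    have hgp := right_ne_zero_of_mul (right_ne_zero_of_mul hne)
    have hpm := (mem_splits₂ m p).1 hp
    rw [← hpm, Prod.fst_mul, deg, grade_mul] at hM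
    exact ⟨p.1, ⟨hfp, by linarith [hB _ hgp]⟩, p.2, ⟨hgp, by linarith [hA _ hfp]⟩, hpm⟩
  add_mem' := by
    intro f g hf hg M
    refine ((hf M).union (hg M)).subset fun p ⟨hp, hM⟩ => ?_
    by_cases hfp : f.coeff p = 0
    · exact Or.inr ⟨fun hgp => hp (by rw [CTensor.coeff_add, hfp, hgp, add_zero]), hM⟩
    · exact Or.inl ⟨hfp, hM⟩
  algebraMap_mem' := by
    intro c M
    refine (Set.finite_singleton 1).subset fun p ⟨hp, _⟩ => ?_
    by_contra h
    rw [Algebra.algebraMap_eq_smul_one, CTensor.coeff_smul, CTensor.coeff_one_of_ne h] at hp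
    exact hp (mul_zero c)

theorem hasFiniteSupport_of_mem_leftFinite {f : CTensor C} (hf : f ∈ leftFinite C)
    {ψ : Word n × Word n → Kv} {M : ℤ} (hψ : ∀ p, ψ p ≠ 0 → deg p.1 ≤ M) :
    (fun p => ψ p * f.coeff p).HasFiniteSupport :=
  (hf M).subset fun p hp => ⟨right_ne_zero_of_mul hp, hψ p (left_ne_zero_of_mul hp)⟩

theorem tmul_word_mem_leftFinite (w w' : Word n) :
    CTensor.tmul C (word w) (word w') ∈ leftFinite C := fun _ =>
  (Set.finite_singleton (w, w')).subset fun _ hp => coeff_tmul_word_ne_zero.1 hp.1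

theorem thetaE_mem_leftFinite (i : Fin n) (l : ℤ) : thetaE C i l ∈ leftFinite C := by
  intro M
  have hfin : (⋃ t ∈ Finset.range (M.toNat + 1),
      (fun w => (w, FreeMonoid.of (PosGen.E i (l - (t : ℕ))))) ''
        ((theta i t).coeff.support : Set (Word n))).Finite :=
    (Finset.finite_toSet _).biUnion fun t _ => (Finset.finite_toSet _).image _
  refine hfin.subset fun p ⟨hp, hM⟩ => ?_
  obtain ⟨t, ht, hp₂⟩ := exists_of_coeff_thetaE_ne_zero hp
  rw [deg_of_coeff_theta ht] at hM
  exact Set.mem_biUnion (Finset.mem_range.2 (by omega))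
    ⟨p.1, Finsupp.mem_support_iff.2 ht, Prod.ext rfl hp₂.symm⟩

theorem deltaGen_mem_leftFinite (g : PosGen n) : deltaGen C g ∈ leftFinite C := by
  cases g with
  | E i l => exact add_mem (tmul_word_mem_leftFinite _ 1) (thetaE_mem_leftFinite i l)
  | H i s => exact add_mem (tmul_word_mem_leftFinite _ 1) (tmul_word_mem_leftFinite 1 _)

theorem delta_mem_leftFinite (x : PosFree n) : delta C x ∈ leftFinite C := by
  induction x using posFree_induction with
  | one => exact map_one (delta C) ▸ one_mem _
  | word_of_mul g x ih =>
    rw [map_mul, delta_word_of]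
    exact mul_mem (deltaGen_mem_leftFinite g) ih
  | add x y hx hy => exact map_add (delta C) x y ▸ add_mem hx hy
  | smul c x hx => exact map_smul (delta C) c x ▸ Subalgebra.smul_mem _ hx c

end LeftFinite

section Leibniz

variable {n : ℕ} {C : CartanDatum n}

theorem twist_mul_counit (p q : Word n × Word n) :
    twist C p q * counit q.1 = counit q.1 := by
  by_cases hq : counit q.1 = 0
  · rw [hq, mul_zero]
  · have htwist : twist C p q = 1 := by
      simp [twist, eq_one_of_counit_ne_zero hq, wt_one, CartanDatum.form]
    rw [htwist, one_mul]

theorem hasFiniteSupport_counit {f : CTensor C} (hf : f ∈ leftFinite C) :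
    (fun p => counit p.1 * f.coeff p).HasFiniteSupport := by
  refine hasFiniteSupport_of_mem_leftFinite hf (M := 0) fun p hp => ?_
  rw [eq_one_of_counit_ne_zero hp]
  exact grade_one.le

theorem coeff_deltaGen_one (g : PosGen n) (w : Word n) :
    (deltaGen C g).coeff (1, w) = (word (FreeMonoid.of g)).coeff w := by
  have hleft (g : PosGen n) : (CTensor.tmul C (word (FreeMonoid.of g)) 1).coeff (1, w) = 0 := by
    by_contra h
    exact FreeMonoid.one_ne_of g (Prod.ext_iff.1 (coeff_tmul_word_ne_zero.1 h)).1
  cases g with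
  | H i s =>
    rw [deltaGen, CTensor.coeff_add, pH, hleft, zero_add, coeff_tmul, ← pH]
    exact (congrArg (· * _) (coeff_word_self 1)).trans (one_mul _)
  | E i l =>
    rw [deltaGen, CTensor.coeff_add, pE, hleft, zero_add]
    by_cases hw : w = FreeMonoid.of (PosGen.E i l)
    · have hθ := coeff_thetaE_of (C := C) i l 1 0
      rw [Nat.cast_zero, sub_zero, theta_zero] at hθ
      rw [hw, hθ, coeff_word_self]
      exact coeff_word_self 1
    · rw [not_not.1 (mt coeff_word_ne_zero.1 hw)]
      by_contra h
      obtain ⟨t, ht, rfl⟩ := exists_of_coeff_thetaE_ne_zero h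
      have ht0 : (t : ℤ) = 0 := (deg_of_coeff_theta ht).symm.trans grade_one
      exact hw (by rw [ht0, sub_zero])

theorem contraction_counit_deltaGen (g : PosGen n) :
    contraction (fun p => counit p.1) (deltaGen C g) = word (FreeMonoid.of g) := by
  rw [contraction, finsum_eq_single _ (1, FreeMonoid.of g)]
  · rw [coeff_deltaGen_one, map_one, coeff_word_self, mul_one, one_smul]
  · rintro ⟨w, w'⟩ hp
    by_contra h
    have hne := left_ne_zero_of_smul h
    obtain rfl := eq_one_of_counit_ne_zero (left_ne_zero_of_mul hne)
    have hw' := right_ne_zero_of_mul hne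
    rw [coeff_deltaGen_one] at hw'
    exact hp (by rw [coeff_word_ne_zero.1 hw'])

theorem contraction_counit_mul {f g : CTensor C} (hf : f ∈ leftFinite C) (hg : g ∈ leftFinite C) :
    contraction (fun p => counit p.1) (f * g) =
      contraction (fun p => counit p.1) f * contraction (fun p => counit p.1) g := by
  rw [contraction_mul (T := {()}) (α := fun _ p => counit p.1) (β := fun _ p => counit p.1)
    (fun _ => hasFiniteSupport_counit hf) (fun _ => hasFiniteSupport_counit hg),
    Finset.sum_singleton]
  intro p q _ _
  rw [Finset.sum_singleton, Prod.fst_mul, map_mul, mul_right_comm, mul_assoc, twist_mul_counit]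

theorem contraction_counit_one :
    contraction (fun p => counit p.1) (1 : CTensor C) = 1 := by
  rw [contraction, finsum_eq_single _ 1 fun p hp => by
    rw [CTensor.coeff_one_of_ne hp, mul_zero, zero_smul]]
  rw [CTensor.coeff_one_one, mul_one]
  exact (congrArg (· • _) (map_one counit)).trans (one_smul _ _)

theorem contraction_counit_delta (x : PosFree n) :
    contraction (fun p => counit p.1) (delta C x) = x := by
  induction x using posFree_induction with
  | one => rw [map_one, contraction_counit_one]
  | word_of_mul g x ih =>
    rw [map_mul, delta_word_of,
      contraction_counit_mul (deltaGen_mem_leftFinite g) (delta_mem_leftFinite x), ih,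
      contraction_counit_deltaGen]
  | add x y hx hy =>
    rw [map_add, contraction_add (hasFiniteSupport_counit (delta_mem_leftFinite x))
      (hasFiniteSupport_counit (delta_mem_leftFinite y)), hx, hy]
  | smul c x hx => rw [map_smul, contraction_smul, hx]

theorem hasFiniteSupport_pairE {f : CTensor C} (hf : f ∈ leftFinite C) (i : Fin n) (m : ℤ) :
    (fun p => pairE C i m p.1.toList * f.coeff p).HasFiniteSupport :=
  hasFiniteSupport_of_mem_leftFinite hf fun _ hp => (wt_deg_of_pairE_ne_zero hp).2.le

theorem Fprime_eq_contraction (i : Fin n) (m : ℤ) (x : PosFree n) :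
    Fprime C i m x =
      (v ^ (-2 : ℤ) - 1) • contraction (fun p => pairE C i m p.1.toList) (delta C x) := by
  simp only [Fprime, contraction, smul_finsum, smul_smul, pairing_pE_word]

theorem Fprime_add (i : Fin n) (m : ℤ) (x y : PosFree n) :
    Fprime C i m (x + y) = Fprime C i m x + Fprime C i m y := by
  rw [Fprime_eq_contraction, map_add,
    contraction_add (hasFiniteSupport_pairE (delta_mem_leftFinite x) i m)
      (hasFiniteSupport_pairE (delta_mem_leftFinite y) i m), smul_add,
    ← Fprime_eq_contraction, ← Fprime_eq_contraction]

theorem Fprime_algebraMap (i : Fin n) (m : ℤ) (c : Kv) :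
    Fprime C i m (algebraMap Kv (PosFree n) c) = 0 := by
  rw [Fprime_eq_contraction, Algebra.algebraMap_eq_smul_one, map_smul, map_one, contraction_smul,
    contraction, finsum_eq_zero_of_forall_eq_zero, smul_zero, smul_zero]
  intro p
  by_cases hp : p = 1
  · rw [hp]
    exact (congrArg (· • _) (zero_mul _)).trans (zero_smul _ _)
  · rw [CTensor.coeff_one_of_ne hp, mul_zero, zero_smul]

/-- The functional `x₁ ⊗ x₂ ↦ v^{-(wt x₂, α_i)} (x₁, θ^+_{i,t})` on words, which gives the
coefficients of the Leibniz rule for `F'_{i,m}`. -/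
def thetaWeight (C : CartanDatum n) (i : Fin n) (t : ℕ) (p : Word n × Word n) : Kv :=
  if deg p.1 = t then thetaChar C i p.1 * v ^ (-C.form (wt p.2) (Pi.single i 1)) else 0

theorem deg_of_thetaWeight_ne_zero {i : Fin n} {t : ℕ} {p : Word n × Word n}
    (hp : thetaWeight C i t p ≠ 0) : deg p.1 = t := by
  by_contra h
  exact hp (if_neg h)

/-- The operator `x ↦ ∑ v^{-(wt x_{(2)}, α_i)} (x_{(1)}, θ^+_{i,t}) x_{(2)}`, by which
`F'_{i,m-t}` is twisted in the Leibniz rule for `F'_{i,m}`. -/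
def thetaContraction (C : CartanDatum n) (i : Fin n) (t : ℕ) (x : PosFree n) : PosFree n :=
  contraction (thetaWeight C i t) (delta C x)

theorem pairE_mul_twist (i : Fin n) (m : ℤ) (p q : Word n × Word n) :
    pairE C i m (p * q).1.toList * twist C p q = pairE C i m p.1.toList * counit q.1 +
      ∑ᶠ t : ℕ, thetaWeight C i t p * pairE C i (m - t) q.1.toList := by
  have htwist : pairE C i (m - deg p.1) q.1.toList * twist C p q =
      v ^ (-C.form (wt p.2) (Pi.single i 1)) * pairE C i (m - deg p.1) q.1.toList := by
    by_cases hq : pairE C i (m - deg p.1) q.1.toList = 0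
    · rw [hq, zero_mul, mul_zero]
    · rw [twist, (wt_deg_of_pairE_ne_zero hq).1, mul_comm]
  have hsum : thetaChar C i p.1 * v ^ (-C.form (wt p.2) (Pi.single i 1)) *
        pairE C i (m - deg p.1) q.1.toList =
      ∑ᶠ t : ℕ, thetaWeight C i t p * pairE C i (m - t) q.1.toList := by
    by_cases hp : thetaChar C i p.1 = 0
    · simp only [thetaWeight, hp, zero_mul, ite_self, finsum_zero]
    obtain ⟨t, ht⟩ := Int.eq_ofNat_of_zero_le (deg_nonneg_of_thetaChar_ne_zero hp)
    rw [finsum_eq_single _ t fun s hs => ?_, thetaWeight, if_pos ht, ht]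
    rw [thetaWeight, if_neg (by omega), zero_mul]
  rw [← hsum, Prod.fst_mul, pairE_mul, add_mul, mul_assoc, mul_comm (counit q.1), twist_mul_counit,
    mul_assoc, htwist, mul_assoc]

theorem exists_forall_pairE_eq_zero (i : Fin n) (m : ℤ) (y : PosFree n) :
    ∃ N : ℕ, ∀ t : ℕ, N ≤ t → ∀ q, (delta C y).coeff q ≠ 0 →
      pairE C i (m - t) q.1.toList = 0 := by
  obtain ⟨B, hB⟩ := exists_le_deg (delta_mem_leftFinite (C := C) y)
  refine ⟨(m - B).toNat + 1, fun t ht q hq => ?_⟩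
  by_contra h
  have hdeg := (wt_deg_of_pairE_ne_zero h).2
  have := hB q hq
  omega

theorem Fprime_mul_eq_sum (i : Fin n) (m : ℤ) (x : PosFree n) {y : PosFree n} {N : ℕ}
    (hN : ∀ t : ℕ, N ≤ t → ∀ q, (delta C y).coeff q ≠ 0 → pairE C i (m - t) q.1.toList = 0) :
    Fprime C i m (x * y) = Fprime C i m x * y +
      ∑ t ∈ Finset.range N, thetaContraction C i t x * Fprime C i (m - t) y := by
  let α : Option ℕ → Word n × Word n → Kv
    | none => fun p => pairE C i m p.1.toList
    | some t => thetaWeight C i t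
  let β : Option ℕ → Word n × Word n → Kv
    | none => fun q => counit q.1
    | some t => fun q => pairE C i (m - t) q.1.toList
  have hα (a : Option ℕ) : (fun p => α a p * (delta C x).coeff p).HasFiniteSupport := by
    cases a with
    | none => exact hasFiniteSupport_pairE (delta_mem_leftFinite x) i m
    | some t =>
      exact hasFiniteSupport_of_mem_leftFinite (delta_mem_leftFinite x) fun p hp =>
        (deg_of_thetaWeight_ne_zero hp).le
  have hβ (a : Option ℕ) : (fun q => β a q * (delta C y).coeff q).HasFiniteSupport := by
    cases a with
    | none => exact hasFiniteSupport_counit (delta_mem_leftFinite y)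
    | some t => exact hasFiniteSupport_pairE (delta_mem_leftFinite y) i (m - t)
  have hψ (p q : Word n × Word n) (hq : (delta C y).coeff q ≠ 0) :
      pairE C i m (p * q).1.toList * twist C p q =
        ∑ a ∈ Finset.insertNone (Finset.range N), α a p * β a q := by
    rw [pairE_mul_twist, Finset.sum_insertNone, finsum_eq_sum_of_support_subset]
    intro t ht
    by_contra h
    exact ht (mul_eq_zero_of_right _ (hN t (by simpa using h) q hq))
  rw [Fprime_eq_contraction, map_mul, contraction_mul hα hβ fun p q _ => hψ p q,
    Finset.sum_insertNone, contraction_counit_delta, smul_add, Finset.smul_sum, ← smul_mul_assoc,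
    ← Fprime_eq_contraction]
  refine congrArg _ (Finset.sum_congr rfl fun t _ => ?_)
  rw [Fprime_eq_contraction i (m - t) y, mul_smul_comm, thetaContraction]

theorem Fprime_mul (i : Fin n) (m : ℤ) (x y : PosFree n) :
    Fprime C i m (x * y) = Fprime C i m x * y +
      ∑ᶠ t : ℕ, thetaContraction C i t x * Fprime C i (m - t) y := by
  obtain ⟨N, hN⟩ := exists_forall_pairE_eq_zero (C := C) i m y
  have hFprime (t : ℕ) (ht : N ≤ t) : Fprime C i (m - t) y = 0 := by
    rw [Fprime_eq_contraction, contraction, finsum_eq_zero_of_forall_eq_zero, smul_zero]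
    intro q
    by_cases hq : (delta C y).coeff q = 0
    · rw [hq, mul_zero, zero_smul]
    · rw [hN t ht q hq, zero_mul, zero_smul]
  rw [Fprime_mul_eq_sum i m x hN, finsum_eq_sum_of_support_subset]
  intro t ht
  by_contra h
  exact ht (mul_eq_zero_of_right _ (hFprime t (by simpa using h)))

end Leibniz

section Kernel

variable {n : ℕ} {C : CartanDatum n} {𝔥 : Type*} [AddCommGroup 𝔥] [Module ℂ 𝔥]

theorem proj_Fprime_mul (ρ : Realization C 𝔥) (i : Fin n) {m : ℤ} (x : PosFree n) {y : PosFree n}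
    (hy : ∀ m' ≤ m, proj ρ (Fprime C i m' y) = 0) :
    proj ρ (Fprime C i m (x * y)) = proj ρ (Fprime C i m x) * proj ρ y := by
  have hsum : proj ρ (∑ᶠ t : ℕ, thetaContraction C i t x * Fprime C i (m - t) y) = 0 := by
    refine finsum_induction (fun z => proj ρ z = 0) (map_zero _)
      (fun z z' hz hz' => by rw [map_add, hz, hz', add_zero]) fun t => ?_
    rw [map_mul, hy _ (by omega), mul_zero]
  rw [Fprime_mul, map_add, hsum, add_zero, map_mul]

/-- The common kernel `Z'_{i,k}` as a subalgebra of `U_v(L𝔫)`. -/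
def zprimeSubalgebra (ρ : Realization C 𝔥) (i : Fin n) (k : ℤ) : Subalgebra Kv (Un ρ) where
  carrier := Zprime ρ i k
  mul_mem' := by
    rintro u w ⟨x, hx, hxu, hx0⟩ ⟨y, hy, hyw, hy0⟩
    refine ⟨x * y, mul_mem hx hy, by rw [map_mul, hxu, hyw, Subalgebra.coe_mul], fun m hm => ?_⟩
    rw [proj_Fprime_mul ρ i x fun m' hm' => hy0 m' (hm'.trans hm), hx0 m hm, zero_mul]
  add_mem' := by
    rintro u w ⟨x, hx, hxu, hx0⟩ ⟨y, hy, hyw, hy0⟩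
    refine ⟨x + y, add_mem hx hy, by rw [map_add, hxu, hyw, Subalgebra.coe_add], fun m hm => ?_⟩
    rw [Fprime_add, map_add, hx0 m hm, hy0 m hm, add_zero]
  algebraMap_mem' c :=
    ⟨algebraMap Kv _ c, Subalgebra.algebraMap_mem _ c, AlgHom.commutes _ c, fun m _ => by
      rw [Fprime_algebraMap, map_zero]⟩

theorem proj_pE (ρ : Realization C 𝔥) (i : Fin n) (l : ℤ) : proj ρ (pE i l) = uE ρ i l := by
  rw [proj, pE, word, MonoidAlgebra.lift_single, one_smul, FreeMonoid.lift_eval_of]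

theorem map_proj_EFree (ρ : Realization C 𝔥) : (EFree n).map (proj ρ) = Un ρ := by
  rw [EFree, Un, AlgHom.map_adjoin]
  congr 1
  ext x
  constructor
  · rintro ⟨_, ⟨i, l, rfl⟩, rfl⟩
    exact ⟨i, l, proj_pE ρ i l⟩
  · rintro ⟨i, l, rfl⟩
    exact ⟨_, ⟨i, l, rfl⟩, proj_pE ρ i l⟩

theorem IsFprime.iInter_ker_eq {ρ : Realization C 𝔥} {i : Fin n} {F : ℤ → Module.End Kv (Un ρ)}
    (hF : IsFprime ρ i F) (k : ℤ) : ⋂ m ≤ k, {u | F m u = 0} = Zprime ρ i k := by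
  ext u
  simp only [Set.mem_iInter, Set.mem_ofPred_eq]
  constructor
  · intro hu
    obtain ⟨x, hx, hxu⟩ : ∃ x ∈ EFree n, proj ρ x = u := (map_proj_EFree ρ).ge u.2
    refine ⟨x, hx, hxu, fun m hm => ?_⟩
    rw [← hF x hx u hxu.symm m, hu m hm, Subalgebra.coe_zero]
  · rintro ⟨x, hx, hxu, h0⟩ m hm
    apply Subtype.ext
    rw [hF x hx u hxu.symm m, h0 m hm, Subalgebra.coe_zero]

end Kernel

end QLoop

end

theorem mainTheorem3 {n : ℕ} (C : QLoop.CartanDatum n)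
    {𝔥 : Type*} [AddCommGroup 𝔥] [Module ℂ 𝔥] (ρ : QLoop.Realization C 𝔥)
    (i : Fin n) (k : ℤ) :
    (∃ S : Subalgebra QLoop.Kv (QLoop.Un ρ), (S : Set (QLoop.Un ρ)) = QLoop.Zprime ρ i k) ∧
    (∀ F : ℤ → Module.End QLoop.Kv (QLoop.Un ρ), QLoop.IsFprime ρ i F →
      ∃ S : Subalgebra QLoop.Kv (QLoop.Un ρ),
        (S : Set (QLoop.Un ρ)) = ⋂ m ≤ k, {u | F m u = 0}) :=
  ⟨⟨QLoop.zprimeSubalgebra ρ i k, rfl⟩, fun _ hF =>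
    ⟨QLoop.zprimeSubalgebra ρ i k, (hF.iInter_ker_eq k).symm⟩⟩
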